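/- In the list model, a directed graph on the vertex set $[n]=\{0,\dots,n-1\}$ in which every vertex has out-degree $k$ is given by a function $f:[n]\times[k]\to[n]$, where $f(u,i)$ is the $i$-th out-neighbour of $u$, under the promise that $f(u,i)\neq f(u,j)$ whenever $i\neq j$. The graph is strongly connected if for all vertices $s,t$ there is a directed path from $s$ to $t$. A quantum algorithm with $T$ queries starts in a fixed basis state and alternates $T+1$ unitaries that do not depend on $f$ with $T$ applications of the query unitary $|u,i,z,w\rangle\mapsto|u,i,(z+f(u,i)) \bmod n,\,w\rangle$ (which acts as the identity on states with a null query index), where $w$ ranges over a finite workspace; finally the state is measured in the computational basis and the outcome determines the answer. The quantum query complexity $Q(n,k)$ of Strong Connectivity in the list model is the least $T$ for which some such algorithm, on every $f$ satisfying the promise, answers correctly whether the graph of $f$ is strongly connected with probability at least $2/3$. **Theorem.** The quantum query complexity of Strong Connectivity for directed graphs with out-degree $k$ in the list model is $O(n\sqrt{k}\log n)$: there is an absolute constant $C>0$ such that, for all integers $n\ge 1$ and $k\ge 0$, $Q(n,k)$ is finite and $$Q(n,k)\le C\,n\sqrt{k}\,\log n .$$ -/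

import Mathlib

/-! ### Quantum query algorithms

The input is a function `x : I → A`, where `I` is a finite set of query indices and `A` is a
finite answer alphabet carrying an abelian group law.
An algorithm acts on the Hilbert space with orthonormal (computational) basis
`Option I × A × W`: a query register, an answer register and a workspace.  One query applies
the unitary `|some i, a, w⟩ ↦ |some i, a + x i, w⟩`, `|none, a, w⟩ ↦ |none, a, w⟩`
(the index `none` stands for the null query). -/

/-- The permutation of the computational basis that one query to `x` performs. -/
def queryPerm {I A : Type} [AddCommGroup A] (W : Type) (x : I → A) :
    Equiv.Perm (Option I × A × W) where
  toFun b := (b.1, b.2.1 + (b.1.elim 0 x), b.2.2)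
  invFun b := (b.1, b.2.1 - (b.1.elim 0 x), b.2.2)
  left_inv b := by simp
  right_inv b := by simp

/-- The query unitary: it sends the basis vector `|b⟩` to `|queryPerm W x b⟩`. -/
noncomputable def queryUnitary {I A : Type} [Fintype I] [Fintype A] [AddCommGroup A]
    (W : Type) [Fintype W] (x : I → A) :
    EuclideanSpace ℂ (Option I × A × W) ≃ₗᵢ[ℂ] EuclideanSpace ℂ (Option I × A × W) :=
  LinearIsometryEquiv.piLpCongrLeft 2 ℂ ℂ (queryPerm W x)

/-- A quantum query algorithm for inputs `x : I → A`.  It starts in the basis state `start`,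
applies `U 0`, then a query, then `U 1`, then a query, and so on, up to the last of its
`queries` queries, followed by `U queries`.  The unitaries `U t` do not depend on the input.
At the end the state is measured in the computational basis, and the algorithm answers "yes"
exactly if the outcome lies in `accept`. -/
structure QuantumQueryAlgorithm (I A : Type) [Fintype I] [Fintype A] where
  /-- labels of the basis states of the workspace -/
  W : Type
  [fintypeW : Fintype W]
  /-- the number of queries -/
  queries : ℕ
  /-- the input-independent unitaries; only `U 0, …, U queries` matter -/
  U : ℕ → (EuclideanSpace ℂ (Option I × A × W) ≃ₗᵢ[ℂ] EuclideanSpace ℂ (Option I × A × W))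
  /-- the initial basis state -/
  start : Option I × A × W
  /-- the accepting measurement outcomes -/
  accept : Finset (Option I × A × W)

namespace QuantumQueryAlgorithm

attribute [instance] QuantumQueryAlgorithm.fintypeW

variable {I A : Type} [Fintype I] [Fintype A] [AddCommGroup A]

open Classical in
/-- The state on input `x` after `t` queries, each followed by its unitary. -/
noncomputable def state (𝒜 : QuantumQueryAlgorithm I A) (x : I → A) :
    ℕ → EuclideanSpace ℂ (Option I × A × 𝒜.W)
  | 0 => 𝒜.U 0 (EuclideanSpace.single 𝒜.start 1)
  | t + 1 => 𝒜.U (t + 1) (queryUnitary 𝒜.W x (𝒜.state x t))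

/-- The probability that the algorithm answers "yes" on input `x`. -/
noncomputable def acceptProb (𝒜 : QuantumQueryAlgorithm I A) (x : I → A) : ℝ :=
  ∑ b ∈ 𝒜.accept, ‖𝒜.state x 𝒜.queries b‖ ^ 2

/-- The algorithm decides the property `D` of inputs satisfying the promise `P` with error
probability at most `1/3`. -/
def Decides (𝒜 : QuantumQueryAlgorithm I A) (P D : (I → A) → Prop) : Prop :=
  ∀ x : I → A, P x →
    (D x → 2 / 3 ≤ 𝒜.acceptProb x) ∧ (¬ D x → 𝒜.acceptProb x ≤ 1 / 3)

end QuantumQueryAlgorithm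

/-- The bounded-error quantum query complexity of deciding `D` under the promise `P`: the least
number of queries of an algorithm that does so (`⊤` if there were no such algorithm). -/
noncomputable def quantumQueryComplexity {I A : Type} [Fintype I] [Fintype A] [AddCommGroup A]
    (P D : (I → A) → Prop) : ℕ∞ :=
  ⨅ (𝒜 : QuantumQueryAlgorithm I A) (_ : 𝒜.Decides P D), (𝒜.queries : ℕ∞)

/-! ### Directed graphs in the list model -/

/-- A directed graph is strongly connected if for all vertices `s` and `t` there is a directed
path from `s` to `t`. -/
def Digraph.StronglyConnected {V : Type*} (G : Digraph V) : Prop :=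
  ∀ s t : V, Relation.ReflTransGen G.Adj s t

/-- The simple graph promise: the `k` listed out-neighbours of each vertex are distinct. -/
def IsSimpleList {n k : ℕ} (f : Fin n × Fin k → Fin n) : Prop :=
  ∀ (u : Fin n) (i j : Fin k), i ≠ j → f (u, i) ≠ f (u, j)

/-- The directed graph that the lists `f` encode: `f (u, i)` is the `i`-th out-neighbour
of `u`. -/
def listDigraph {n k : ℕ} (f : Fin n × Fin k → Fin n) : Digraph (Fin n) where
  Adj u v := ∃ i : Fin k, f (u, i) = v

/-- The quantum query complexity of Strong Connectivity for directed graphs with `n` vertices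
and out-degree `k` in the list model. -/
noncomputable def strongConnectivityQueryComplexity (n k : ℕ) [NeZero n] : ℕ∞ :=
  quantumQueryComplexity (I := Fin n × Fin k) (A := Fin n) IsSimpleList
    (fun f => (listDigraph f).StronglyConnected)

/-! A bounded-error algorithm comes from a feasible point of the dual adversary bound, and that
point from a classical depth-first search with guessed answers.

Search: explore from one vertex, contracting each directed cycle found, so that the current path is
a chain of contracted components. Always query an unqueried edge out of the top component and guess
that it stays there. A wrong guess either reaches a new vertex or contracts a cycle, so there are at
most `2n` of them among at most `nk` queries. When the top component has no unqueried edge it is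
closed under successors, so the graph is strongly connected iff that component is everything
(`IsExplored.stronglyConnected_iff`).

Cost: `HasAdversaryCertificate.query` charges `2s²` for a right guess and `(s² + s⁻²)/2` for a wrong
one. With `s² = 1/√k` the total is at most `4n√k`.

Algorithm: `HasAdversaryCertificate.exists_algorithm` turns value `c` into `O(c)` queries with
constant error. This gives `O(n√k)`, and the logarithm in the theorem is slack. -/

/-- Two families of vectors with the same Gram matrix differ by a unitary. -/
theorem exists_linearIsometryEquiv_of_inner_eq {E ι : Type*} [NormedAddCommGroup E]
    [InnerProductSpace ℂ E] [FiniteDimensional ℂ E] (a b : ι → E)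
    (h : ∀ i j, inner ℂ (a i) (a j) = inner ℂ (b i) (b j)) :
    ∃ U : E ≃ₗᵢ[ℂ] E, ∀ i, U (a i) = b i := by
  set α := Finsupp.linearCombination ℂ a
  set β := Finsupp.linearCombination ℂ b
  -- Equal norms make `α c ↦ β c` well defined and isometric on the span of `a`; finite dimension
  -- then extends it to a unitary.
  have hnorm : ∀ c, ‖α c‖ = ‖β c‖ := by
    intro c
    have : inner ℂ (α c) (α c) = inner ℂ (β c) (β c) := by
      simp only [α, β, Finsupp.linearCombination_apply, Finsupp.sum_inner, Finsupp.inner_sum,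
        inner_smul_left, inner_smul_right, h]
    rw [inner_self_eq_norm_sq_to_K, inner_self_eq_norm_sq_to_K] at this
    have h2 : ‖α c‖ ^ 2 = ‖β c‖ ^ 2 := by exact_mod_cast this
    exact (sq_eq_sq₀ (norm_nonneg _) (norm_nonneg _)).1 h2
  have hker : LinearMap.ker α ≤ LinearMap.ker β := by
    intro c hc
    rw [LinearMap.mem_ker] at hc ⊢
    rw [← norm_eq_zero, ← hnorm, hc, norm_zero]
  let f : LinearMap.range α →ₗ[ℂ] E :=
    (Submodule.liftQ _ β hker).comp α.quotKerEquivRange.symm.toLinearMap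
  have hf : ∀ c (hc : α c ∈ LinearMap.range α), f ⟨α c, hc⟩ = β c := by
    intro c hc
    have : α.quotKerEquivRange.symm ⟨α c, hc⟩ = Submodule.Quotient.mk c := by
      rw [LinearEquiv.symm_apply_eq]
      rfl
    simp [f, this]
  let V : LinearMap.range α →ₗᵢ[ℂ] E := ⟨f, by
    rintro ⟨_, c, rfl⟩
    exact (congrArg norm (hf c _)).trans (hnorm c).symm⟩
  refine ⟨V.extend.toLinearIsometryEquiv rfl, fun i => ?_⟩
  have hi : α (Finsupp.single i 1) = a i := by simp [α]
  have hb : β (Finsupp.single i 1) = b i := by simp [β]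
  rw [LinearIsometry.toLinearIsometryEquiv_apply, ← hi, ← hb]
  exact (V.extend_apply ⟨α (Finsupp.single i 1), LinearMap.mem_range_self _ _⟩).trans (hf _ _)

/-! ### States with a prescribed answer for each query index and label -/

section RegisterVec

variable {I A L : Type} [AddCommGroup A]

open Classical in
/-- The vector whose null-query part is `∑ o, c o |none, 0, o⟩` and whose part with query
index `i` is `∑ l, r i l |i, g i l, l⟩`. -/
noncomputable def registerVec (c : Option Bool → ℝ) (g : I → L → A) (r : I → L → ℝ) :
    EuclideanSpace ℂ (Option I × A × (Option Bool ⊕ L)) :=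
  WithLp.toLp 2 fun b => match b with
    | (none, a, Sum.inl o) => if a = 0 then (c o : ℂ) else 0
    | (some i, a, Sum.inr l) => if a = g i l then (r i l : ℂ) else 0
    | (none, _, Sum.inr _) => 0
    | (some _, _, Sum.inl _) => 0

variable [Fintype I] [Fintype A] [Fintype L]

-- Distinct answers are orthogonal, so a label contributes only where `g` and `g'` agree. A query
-- changes Gram matrices by changing where they agree.
open Classical in
theorem inner_registerVec (c c' : Option Bool → ℝ) (g g' : I → L → A) (r r' : I → L → ℝ) :
    inner ℂ (registerVec c g r) (registerVec c' g' r') =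
      ((∑ o, c o * c' o + ∑ i, ∑ l, if g i l = g' i l then r i l * r' i l else 0 : ℝ) : ℂ) := by
  rw [PiLp.inner_apply]
  simp only [registerVec, Fintype.sum_prod_type (α₁ := Option I), Fintype.sum_option (α := I),
    Fintype.sum_prod_type (α₁ := A), Fintype.sum_sum_type, inner_zero_left,
    Finset.sum_const_zero, add_zero, zero_add]
  push_cast
  congr 1
  · rw [Finset.sum_comm]
    refine Finset.sum_congr rfl fun o _ => ?_
    rw [Finset.sum_eq_single 0] <;> simp +contextual [mul_comm]
  · refine Finset.sum_congr rfl fun i _ => ?_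
    rw [Finset.sum_comm]
    refine Finset.sum_congr rfl fun l _ => ?_
    rw [Finset.sum_eq_single (g i l)]
    · by_cases h : g i l = g' i l <;> simp [h, mul_comm]
    · simp +contextual
    · simp

open Classical in
theorem queryUnitary_registerVec (x : I → A) (c : Option Bool → ℝ) (g : I → L → A)
    (r : I → L → ℝ) :
    queryUnitary (Option Bool ⊕ L) x (registerVec c g r) =
      registerVec c (fun i l => g i l + x i) r := by
  ext ⟨i, a, w⟩
  rw [queryUnitary, LinearIsometryEquiv.piLpCongrLeft_apply]
  rcases i with _ | i <;> rcases w with w | w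
  · exact if_congr (by simp) rfl rfl
  · rfl
  · rfl
  · exact if_congr (by simp [sub_eq_iff_eq_add]) rfl rfl

end RegisterVec

/-! ### Dual adversary certificates -/

section Certificate

variable {I A : Type} [Fintype I]

open Classical in
/-- A feasible solution, of objective value at most `c`, of the dual adversary bound for the
decision problem `D` under the promise `P`, in the form with one positive and one negative
part. -/
def HasAdversaryCertificate (P D : (I → A) → Prop) (c : ℝ) : Prop :=
  ∃ (L : Type) (_ : Fintype L) (p q : (I → A) → I → L → ℝ),
    (∀ x y, P x → P y →
      (∑ i, if x i = y i then 0 else ∑ l, (p x i l * p y i l - q x i l * q y i l)) =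
        if (D x ↔ D y) then 0 else 1) ∧
    ∀ x, P x → ∑ i, ∑ l, (p x i l ^ 2 + q x i l ^ 2) ≤ c

end Certificate

/-! ### Certificates from decision trees with guesses -/

section Certificate

variable {I A : Type} [Fintype I]

/-- A decision that is constant on the promise has a certificate of value `0`. -/
theorem hasAdversaryCertificate_of_const {P D : (I → A) → Prop}
    (h : ∀ x y, P x → P y → (D x ↔ D y)) : HasAdversaryCertificate P D 0 :=
  ⟨Empty, inferInstance, fun _ _ => Empty.elim, fun _ _ => Empty.elim,
    fun x y hx hy => by simp [h x y hx hy], fun x _ => by simp⟩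

theorem HasAdversaryCertificate.mono {P P' D : (I → A) → Prop} {c c' : ℝ}
    (h : HasAdversaryCertificate P D c) (hP : ∀ x, P' x → P x) (hc : c ≤ c') :
    HasAdversaryCertificate P' D c' := by
  obtain ⟨L, hL, p, q, h1, h2⟩ := h
  exact ⟨L, hL, p, q, fun x y hx hy => h1 x y (hP x hx) (hP y hy),
    fun x hx => (h2 x (hP x hx)).trans hc⟩

open Classical in
/-- One query `i` of a classical decision tree, with a guess that the answer lies in `S`.  If
the guess is right, the tree goes on in a way that does not depend on the answer. -/
theorem HasAdversaryCertificate.query [Fintype A] {P D : (I → A) → Prop} (i : I) (S : Set A)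
    {s c : ℝ} (hs : 0 < s)
    (hright : HasAdversaryCertificate (fun x => P x ∧ x i ∈ S) D (c - 2 * s ^ 2))
    (hwrong : ∀ a ∉ S, HasAdversaryCertificate (fun x => P x ∧ x i = a) D
      (c - (s ^ 2 + (s⁻¹) ^ 2) / 2)) :
    HasAdversaryCertificate P D c := by
  obtain ⟨L, hL, p, q, hpq, hc⟩ := hright
  have hw : ∀ a : {a : A // a ∉ S}, HasAdversaryCertificate (fun x => P x ∧ x i = a) D
      (c - (s ^ 2 + (s⁻¹) ^ 2) / 2) := fun a => hwrong a a.2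
  choose L' hL' p' q' hpq' hc' using hw
  let ext (w : (I → A) → Bool → ℝ) (v : (I → A) → I → L → ℝ)
      (v' : ∀ a : {a : A // a ∉ S}, (I → A) → I → L' a → ℝ) (x : I → A) (j : I) :
      Bool ⊕ (L ⊕ (Σ a, L' a)) → ℝ :=
    Sum.elim (fun b => if j = i then w x b else 0)
      (Sum.elim (fun l => if x i ∈ S then v x j l else 0)
        (fun l => if x i = l.1 then v' l.1 x j l.2 else 0))
  -- The weights separate `D x` from `D y` at index `i` unless both guesses are right: `p·p - q·q`
  -- vanishes for two right guesses, and otherwise is `1` or `0` as the decisions differ or agree.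
  -- Two right guesses are left to the shared continuation, two equal wrong answers to the branch of
  -- that answer.
  let wp (x : I → A) (b : Bool) : ℝ :=
    if x i ∈ S then (if b = decide (D x) then s else 0)
    else (if b = decide (D x) then s / 2 else s⁻¹ / 2)
  let wq (x : I → A) (b : Bool) : ℝ :=
    if x i ∈ S then (if b = decide (D x) then s else 0)
    else (if b = decide (D x) then s / 2 else - (s⁻¹ / 2))
  refine ⟨Bool ⊕ (L ⊕ (Σ a, L' a)), inferInstance, ext wp p p', ext wq q q', ?_, ?_⟩
  · intro x y hx hy
    have hsplit : ∀ j, (if x j = y j then 0 else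
        ∑ l, (ext wp p p' x j l * ext wp p p' y j l - ext wq q q' x j l * ext wq q q' y j l)) =
        (if j = i then (if x j = y j then 0 else ∑ b, (wp x b * wp y b - wq x b * wq y b)) else 0)
        + (if x i ∈ S ∧ y i ∈ S then
            (if x j = y j then 0 else ∑ l, (p x j l * p y j l - q x j l * q y j l)) else 0)
        + ∑ a : {a : A // a ∉ S}, if x i = a ∧ y i = a then
            (if x j = y j then 0 else
              ∑ l, (p' a x j l * p' a y j l - q' a x j l * q' a y j l)) else 0 := by
      intro j
      by_cases hj : x j = y j
      · simp [hj]
      · simp only [hj, if_false, Fintype.sum_sum_type, Fintype.sum_sigma, ext, Sum.elim_inl,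
          Sum.elim_inr, ← add_assoc]
        congr 1
        · congr 1
          · split_ifs <;> simp
          · by_cases h1 : x i ∈ S <;> by_cases h2 : y i ∈ S <;> simp [h1, h2]
        · refine Finset.sum_congr rfl fun a _ => ?_
          by_cases h1 : x i = a <;> by_cases h2 : y i = a <;> simp [h1, h2]
    simp only [hsplit, Finset.sum_add_distrib, Finset.sum_ite_eq', Finset.mem_univ, if_true]
    rw [Finset.sum_comm (s := Finset.univ (α := I))]
    have hterm : ∀ a : {a : A // a ∉ S}, (∑ j, if x i = a ∧ y i = a then
            (if x j = y j then 0 else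
              ∑ l, (p' a x j l * p' a y j l - q' a x j l * q' a y j l)) else 0) =
        if x i = a ∧ y i = a then (if (D x ↔ D y) then 0 else 1) else 0 := by
      intro a
      by_cases h : x i = a ∧ y i = a
      · simp only [h, and_self, if_true]
        exact hpq' a x y ⟨hx, h.1⟩ ⟨hy, h.2⟩
      · simp only [h, if_false, Finset.sum_const_zero]
    simp only [hterm]
    have hss : s * s⁻¹ = 1 := mul_inv_cancel₀ hs.ne'
    by_cases h1 : x i ∈ S <;> by_cases h2 : y i ∈ S
    · have h3 : ∀ a : {a : A // a ∉ S}, x i ≠ a := fun a h => a.2 (h ▸ h1)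
      simp only [h1, h2, h3, and_self, if_true, false_and, if_false, Finset.sum_const_zero,
        add_zero]
      rw [hpq x y ⟨hx, h1⟩ ⟨hy, h2⟩]
      simp [wp, wq, h1, h2]
    · have h3 : ∀ a : {a : A // a ∉ S}, x i ≠ a := fun a h => a.2 (h ▸ h1)
      have h4 : x i ≠ y i := fun h => h2 (h ▸ h1)
      by_cases hx : D x <;> by_cases hy : D y <;>
        simp [wp, wq, h1, h2, h3, h4, hx, hy] <;> linear_combination hss
    · have h3 : ∀ a : {a : A // a ∉ S}, y i ≠ a := fun a h => a.2 (h ▸ h2)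
      have h4 : x i ≠ y i := fun h => h1 (h ▸ h2)
      by_cases hx : D x <;> by_cases hy : D y <;>
        simp [wp, wq, h1, h2, h3, h4, hx, hy] <;> linear_combination hss
    · by_cases h4 : x i = y i
      · have h5 : ∀ a : {a : A // a ∉ S}, (x i = a ∧ y i = a) ↔ a = ⟨y i, h2⟩ := by
          intro a
          rw [h4, and_self, Subtype.ext_iff, eq_comm]
        simp only [h5, Finset.sum_ite_eq', Finset.mem_univ, if_true]
        simp [h4, h2]
      · have h5 : ∀ a : {a : A // a ∉ S}, ¬ (x i = a ∧ y i = a) :=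
          fun a h => h4 (h.1.trans h.2.symm)
        simp only [h5, if_false, Finset.sum_const_zero]
        by_cases hx : D x <;> by_cases hy : D y <;>
          simp [wp, wq, h1, h2, h4, hx, hy] <;> linear_combination hss
  · intro x hx
    have hsplit : ∀ j, ∑ l, (ext wp p p' x j l ^ 2 + ext wq q q' x j l ^ 2) =
        (if j = i then ∑ b, (wp x b ^ 2 + wq x b ^ 2) else 0)
        + (if x i ∈ S then ∑ l, (p x j l ^ 2 + q x j l ^ 2) else 0)
        + ∑ a : {a : A // a ∉ S}, if x i = a then
            ∑ l, (p' a x j l ^ 2 + q' a x j l ^ 2) else 0 := by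
      intro j
      simp only [Fintype.sum_sum_type, Fintype.sum_sigma, ext, Sum.elim_inl,
        Sum.elim_inr, ← add_assoc]
      congr 1
      · congr 1
        · split_ifs <;> simp
        · split_ifs <;> simp
      · refine Finset.sum_congr rfl fun a _ => ?_
        split_ifs <;> simp
    rw [Finset.sum_congr rfl fun j _ => hsplit j, Finset.sum_add_distrib, Finset.sum_add_distrib,
      Finset.sum_ite_eq', if_pos (Finset.mem_univ i), Finset.sum_comm (s := Finset.univ (α := I))]
    by_cases h1 : x i ∈ S
    · have h3 : ∀ a : {a : A // a ∉ S}, x i ≠ a := fun a h => a.2 (h ▸ h1)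
      have h4 : ∑ b, (wp x b ^ 2 + wq x b ^ 2) = 2 * s ^ 2 := by
        by_cases hD : D x <;> simp [wp, wq, h1, hD] <;> ring
      simp only [h3, h1, h4, if_true, if_false, Finset.sum_const_zero]
      linarith [hc x ⟨hx, h1⟩]
    · have h3 : ∀ a : {a : A // a ∉ S}, x i = a ↔ a = ⟨x i, h1⟩ := by
        intro a
        rw [Subtype.ext_iff, eq_comm]
      have h4 : ∑ b, (wp x b ^ 2 + wq x b ^ 2) = (s ^ 2 + (s⁻¹) ^ 2) / 2 := by
        by_cases hD : D x <;> simp only [wp, wq, h1, hD] <;> simp <;> ring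
      rw [Finset.sum_eq_single (⟨x i, h1⟩ : {a : A // a ∉ S}) _ (by simp)]
      · simp only [h1, h4, if_true, if_false, Finset.sum_const_zero]
        linarith [hc' ⟨x i, h1⟩ x ⟨hx, rfl⟩]
      · intro a _ ha
        simp [mt (h3 a).1 ha]

end Certificate

/-! ### From certificates to query algorithms -/

section Algorithm

variable {I A : Type} [Fintype I] [Fintype A] [AddCommGroup A]

theorem QuantumQueryAlgorithm.quantumQueryComplexity_le {P D : (I → A) → Prop}
    (𝒜 : QuantumQueryAlgorithm I A) (h : 𝒜.Decides P D) :
    quantumQueryComplexity P D ≤ (𝒜.queries : ℕ∞) :=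
  iInf₂_le 𝒜 h

open Classical in
/-- A decision that is constant on the promise needs no query. -/
theorem quantumQueryComplexity_eq_zero_of_const {P D : (I → A) → Prop}
    (h : ∀ x y, P x → P y → (D x ↔ D y)) : quantumQueryComplexity P D = 0 := by
  let 𝒜 : QuantumQueryAlgorithm I A :=
    { W := Unit
      queries := 0
      U := fun _ => LinearIsometryEquiv.refl ℂ _
      start := (none, 0, ())
      accept := if ∃ x, P x ∧ D x then {(none, 0, ())} else ∅ }
  refine le_antisymm (𝒜.quantumQueryComplexity_le fun x hx => ?_) zero_le
  by_cases hD : D x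
  · have h1 : ∃ x, P x ∧ D x := ⟨x, hx, hD⟩
    have : 𝒜.acceptProb x = 1 := by
      simp [QuantumQueryAlgorithm.acceptProb, 𝒜, h1, QuantumQueryAlgorithm.state]
    rw [this]
    norm_num [hD]
  · have h1 : ¬ ∃ x, P x ∧ D x := fun ⟨y, hy, hDy⟩ => hD ((h y x hy hx).1 hDy)
    have : 𝒜.acceptProb x = 0 := by
      simp [QuantumQueryAlgorithm.acceptProb, 𝒜, h1]
    rw [this]
    norm_num [hD]

open Classical in
/-- The quantum algorithm built from a certificate. -/
theorem HasAdversaryCertificate.exists_algorithm {P D : (I → A) → Prop} {c : ℝ}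
    (h : HasAdversaryCertificate P D c) {K : ℕ} (hK : 0 < K) (hcK : 144 * c ≤ K) :
    ∃ 𝒜 : QuantumQueryAlgorithm I A, 𝒜.queries = K ∧ 𝒜.Decides P D := by
  obtain ⟨L, hL, p, q, hpq, hc⟩ := h
  have hK' : (0 : ℝ) < K := by exact_mod_cast hK
  let δ : ℝ := Real.sqrt (1 / K)
  have hδ : δ ^ 2 = 1 / K := Real.sq_sqrt (by positivity)
  let r (x : I → A) (i : I) : L ⊕ L → ℝ := Sum.elim (fun l => δ * p x i l) (fun l => δ * q x i l)
  -- A query sends the answers `0` and `-x i` to `x i` and `0`. Before it the `p` parts always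
  -- overlap and the `q` parts only where `x i = y i`; afterwards the roles are swapped. The Gram
  -- matrix thus drops by `1/K` exactly when the decisions differ, matching the step from `t/K` to
  -- `(t+1)/K` in `e`.
  let g (x : I → A) (i : I) : L ⊕ L → A := Sum.elim (fun _ => 0) (fun _ => - x i)
  let e (τ : ℝ) (x : I → A) : Option Bool → ℝ := fun o =>
    o.elim (Real.sqrt (1 - τ)) fun b => if b = decide (D x) then Real.sqrt τ else 0
  let ψ (t : ℕ) (x : I → A) := registerVec (e (t / K) x) (g x) (r x)
  have hU : ∀ t : ℕ, t < K →
      ∃ U : EuclideanSpace ℂ (Option I × A × (Option Bool ⊕ (L ⊕ L))) ≃ₗᵢ[ℂ]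
      EuclideanSpace ℂ (Option I × A × (Option Bool ⊕ (L ⊕ L))),
      ∀ x : {x // P x}, U (queryUnitary _ x.1 (ψ t x)) = ψ (t + 1) x := by
    intro t ht
    refine exists_linearIsometryEquiv_of_inner_eq _ _ fun x y => ?_
    have key := hpq x y x.2 y.2
    have he : ∀ τ : ℝ, 0 ≤ τ → τ ≤ 1 → ∑ o, e τ x o * e τ y o =
        1 - τ * if (D x ↔ D y) then 0 else 1 := by
      intro τ h0 h1
      have h2 := Real.mul_self_sqrt h0
      have h3 := Real.mul_self_sqrt (sub_nonneg.2 h1)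
      by_cases hx : D x <;> by_cases hy : D y <;> simp [e, hx, hy, h2, h3, Fintype.sum_option]
    have ht' : (t : ℝ) + 1 ≤ K := by exact_mod_cast ht
    simp only [ψ, queryUnitary_registerVec, inner_registerVec]
    congr 1
    rw [he _ (by positivity) (by rw [div_le_one hK']; linarith),
      he _ (by positivity) (by rw [div_le_one hK']; push_cast; exact ht'), ← key]
    have hterm : ∀ i, (∑ l, if g x i l = g y i l then r x i l * r y i l else 0) =
        (∑ l, if g x i l + x.1 i = g y i l + y.1 i then r x i l * r y i l else 0) +
        1 / K * if x.1 i = y.1 i then 0 else ∑ l, (p x i l * p y i l - q x i l * q y i l) := by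
      intro i
      have hm : ∀ u v : ℝ, δ * u * (δ * v) = 1 / K * (u * v) := fun u v => by rw [← hδ]; ring
      by_cases hi : x.1 i = y.1 i
      · simp [g, r, hi]
      · simp [g, r, hi, hm, Finset.mul_sum, mul_sub]
    simp only [hterm, Finset.sum_add_distrib, ← Finset.mul_sum]
    push_cast
    field_simp
    ring
  choose! U hU using hU
  let 𝒜 : QuantumQueryAlgorithm I A :=
    { W := Option Bool ⊕ (L ⊕ L)
      queries := K
      U := fun t => t.casesOn (LinearIsometryEquiv.refl ℂ _) U
      start := (none, 0, Sum.inl none)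
      accept := {(none, 0, Sum.inl (some true))} }
  refine ⟨𝒜, rfl, fun x hx => ?_⟩
  have hstart : EuclideanSpace.single 𝒜.start (1 : ℂ) =
      registerVec (e 0 x) (g x) (0 : I → L ⊕ L → ℝ) := by
    ext ⟨i, a, w⟩
    rw [PiLp.single_apply]
    rcases i with _ | i <;> rcases w with (_ | w) | w <;>
      simp [registerVec, e, 𝒜]
  have hnorm : ∀ c : Option Bool → ℝ,
      ‖registerVec c (g x) (r x) - registerVec c (g x) 0‖ ≤ 1 / 12 := by
    intro c'
    have h0 : registerVec c' (g x) (r x) - registerVec c' (g x) 0 =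
        registerVec 0 (g x) (r x) := by
      ext ⟨i, a, w⟩
      rcases i with _ | i <;> rcases w with w | w <;> simp [registerVec]
    have h1 := inner_registerVec 0 0 (g x) (g x) (r x) (r x)
    rw [inner_self_eq_norm_sq_to_K] at h1
    have h2 : ‖registerVec 0 (g x) (r x)‖ ^ 2 = 1 / K * ∑ i, ∑ l, (p x i l ^ 2 + q x i l ^ 2) := by
      simp only [Pi.zero_apply, mul_zero, Finset.sum_const_zero, zero_add, if_true] at h1
      have h3 : ‖registerVec 0 (g x) (r x)‖ ^ 2 = ∑ i, ∑ l, r x i l * r x i l := by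
        exact Complex.ofReal_injective ((Complex.ofReal_pow _ _).trans h1)
      rw [h3, ← hδ]
      simp only [r, Fintype.sum_sum_type, Finset.mul_sum, Sum.elim_inl, Sum.elim_inr,
        ← Finset.sum_add_distrib]
      exact Finset.sum_congr rfl fun i _ => Finset.sum_congr rfl fun l _ => by ring
    rw [h0]
    -- The factor `144 = 12²` makes the register part small. It is dropped once at the start and
    -- once at the end, for a total error of `1/6`.
    have h3 : ‖registerVec 0 (g x) (r x)‖ ^ 2 ≤ 1 / 144 := by
      rw [h2, div_mul_eq_mul_div, one_mul, div_le_div_iff₀ hK' (by norm_num)]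
      linarith [hc x hx]
    nlinarith [norm_nonneg (registerVec 0 (g x) (r x))]
  have hdist : ∀ t ≤ K, ‖𝒜.state x t - ψ t x‖ ≤ 1 / 12 := by
    intro t
    induction t with
    | zero =>
      intro _
      have : 𝒜.state x 0 = EuclideanSpace.single 𝒜.start (1 : ℂ) := by
        simp [QuantumQueryAlgorithm.state, 𝒜]
        congr!
      rw [this, hstart, norm_sub_rev]
      simpa [ψ] using hnorm (e 0 x)
    | succ t ih =>
      intro ht
      have h1 : ψ (t + 1) x = U t (queryUnitary _ x (ψ t x)) := (hU t ht ⟨x, hx⟩).symm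
      have h2 : 𝒜.state x (t + 1) = U t (queryUnitary _ x (𝒜.state x t)) := rfl
      rw [h1, h2, ← map_sub, ← map_sub, LinearIsometryEquiv.norm_map,
        LinearIsometryEquiv.norm_map]
      exact ih (by omega)
  have hfin : ‖𝒜.state x K - registerVec (e 1 x) (g x) 0‖ ≤ 1 / 6 := by
    have h1 := hdist K le_rfl
    have h2 : ψ K x = registerVec (e 1 x) (g x) (r x) := by simp [ψ, hK'.ne']
    rw [h2] at h1
    linarith [hnorm (e 1 x), norm_sub_le_norm_sub_add_norm_sub (𝒜.state x K)
      (registerVec (e 1 x) (g x) (r x)) (registerVec (e 1 x) (g x) 0)]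
  have hacc := (PiLp.norm_apply_le _ (none, 0, Sum.inl (some true))).trans hfin
  have hprob : 𝒜.acceptProb x = ‖𝒜.state x K (none, 0, Sum.inl (some true))‖ ^ 2 := by
    simp [QuantumQueryAlgorithm.acceptProb, 𝒜]
  rw [hprob]
  set z : ℂ := 𝒜.state x K (none, 0, Sum.inl (some true))
  by_cases hD : D x
  · have h1 : ‖z - 1‖ ≤ 1 / 6 := by simpa [registerVec, e, hD] using hacc
    have h2 : 5 / 6 ≤ ‖z‖ := by
      have := norm_sub_norm_le (1 : ℂ) z
      rw [norm_sub_rev] at this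
      simp only [norm_one] at this
      linarith
    exact ⟨fun _ => by nlinarith, fun h => absurd hD h⟩
  · have h1 : ‖z‖ ≤ 1 / 6 := by simpa [registerVec, e, hD] using hacc
    exact ⟨fun h => absurd h hD, fun _ => by nlinarith [norm_nonneg z]⟩

end Algorithm

/-! ### Depth-first search with contraction of cycles -/

section StrongConnectivity

variable {n k : ℕ}

/-- What a depth-first search with contraction of cycles knows.  The vertices `V` have been
reached and the edges `E` have been queried.  The level `h` numbers the contracted components
along the current search path, so a vertex reaches every vertex whose level is at least its
own, and no queried edge leads to a lower level. -/
def IsExplored (V : Finset (Fin n)) (h : Fin n → ℕ) (E : Finset (Fin n × Fin k))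
    (f : Fin n × Fin k → Fin n) : Prop :=
  (∀ u ∈ V, ∀ v ∈ V, h u ≤ h v → Relation.ReflTransGen (listDigraph f).Adj u v) ∧
    ∀ e ∈ E, e.1 ∈ V ∧ f e ∈ V ∧ h e.1 ≤ h (f e)

variable {V : Finset (Fin n)} {h : Fin n → ℕ} {E : Finset (Fin n × Fin k)}
  {f : Fin n × Fin k → Fin n} {m : ℕ} {e : Fin n × Fin k}

theorem IsExplored.insert_same_level (H : IsExplored V h E f) (he : e.1 ∈ V) (hf : f e ∈ V)
    (hl : h e.1 ≤ h (f e)) : IsExplored V h (insert e E) f := by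
  refine ⟨H.1, fun e' he' => ?_⟩
  rcases Finset.mem_insert.1 he' with rfl | he'
  · exact ⟨he, hf, hl⟩
  · exact H.2 e' he'

theorem IsExplored.insert_new_vertex (H : IsExplored V h E f) (hm : ∀ v ∈ V, h v ≤ m)
    (he : e.1 ∈ V) (hem : h e.1 = m) (hf : f e ∉ V) :
    IsExplored (insert (f e) V) (Function.update h (f e) (m + 1)) (insert e E) f := by
  have hold : ∀ v ∈ V, Function.update h (f e) (m + 1) v = h v := fun v hv =>
    Function.update_of_ne (ne_of_mem_of_not_mem hv hf) _ _
  have hnew : Function.update h (f e) (m + 1) (f e) = m + 1 := Function.update_self _ _ _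
  constructor
  · intro u hu v hv huv
    rcases Finset.mem_insert.1 hu with rfl | hu <;> rcases Finset.mem_insert.1 hv with rfl | hv
    · exact .refl
    · rw [hnew, hold v hv] at huv
      have := hm v hv
      omega
    · exact (H.1 u hu e.1 he (hem ▸ hm u hu)).tail ⟨e.2, rfl⟩
    · rw [hold u hu, hold v hv] at huv
      exact H.1 u hu v hv huv
  · intro e' he'
    rcases Finset.mem_insert.1 he' with rfl | he'
    · refine ⟨Finset.mem_insert_of_mem he, Finset.mem_insert_self _ _, ?_⟩
      rw [hnew, hold _ he]
      omega
    · obtain ⟨h1, h2, h3⟩ := H.2 e' he'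
      refine ⟨Finset.mem_insert_of_mem h1, Finset.mem_insert_of_mem h2, ?_⟩
      rwa [hold _ h1, hold _ h2]

/-- The edge from the top level back to `f e` closes a cycle through all levels from `h (f e)`
upwards, so these collapse into one. -/
theorem IsExplored.contract (H : IsExplored V h E f) (hm : ∀ v ∈ V, h v ≤ m)
    (he : e.1 ∈ V) (hem : h e.1 = m) (hf : f e ∈ V) :
    IsExplored V (fun v => min (h v) (h (f e))) (insert e E) f := by
  constructor
  · intro u hu v hv huv
    by_cases h1 : h u ≤ h v
    · exact H.1 u hu v hv h1
    · have h2 : h (f e) ≤ h v := by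
        simp only [min_def] at huv
        split_ifs at huv <;> omega
      exact ((H.1 u hu e.1 he (hem ▸ hm u hu)).tail ⟨e.2, rfl⟩).trans (H.1 _ hf v hv h2)
  · intro e' he'
    rcases Finset.mem_insert.1 he' with rfl | he'
    · exact ⟨he, hf, by simp⟩
    · obtain ⟨h1, h2, h3⟩ := H.2 e' he'
      exact ⟨h1, h2, min_le_min_right _ h3⟩

/-- Once all edges out of the top component have been queried, the answer is known. -/
theorem IsExplored.stronglyConnected_iff (H : IsExplored V h E f) (hm : ∀ v ∈ V, h v ≤ m)
    (hne : ∃ v ∈ V, h v = m) (hE : ∀ e : Fin n × Fin k, e.1 ∈ V → h e.1 = m → e ∈ E) :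
    (listDigraph f).StronglyConnected ↔ ∀ v, v ∈ V ∧ h v = m := by
  constructor
  · intro hsc v
    obtain ⟨u, hu, hum⟩ := hne
    -- Edges never descend in level and `m` is maximal, so no path leaves the top component.
    refine Relation.ReflTransGen.head_induction_on (motive := fun a _ => a ∈ V ∧ h a = m →
      v ∈ V ∧ h v = m) (hsc u v) id (fun {a b} hab _ ih ha => ih ?_) ⟨hu, hum⟩
    obtain ⟨i, rfl⟩ := hab
    obtain ⟨-, h2, h3⟩ := H.2 (a, i) (hE (a, i) ha.1 ha.2)
    exact ⟨h2, le_antisymm (hm _ h2) (ha.2 ▸ h3)⟩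
  · intro hall s t
    exact H.1 s (hall s).1 t (hall t).1 ((hall s).2.trans (hall t).2.symm).le

/-- The certificate given by depth-first search with contraction of cycles, with the guess that
the next edge stays in the top component.  Every wrong guess discovers a vertex or contracts a
cycle. -/
theorem hasAdversaryCertificate_isExplored {s : ℝ} (hs : 0 < s) (V : Finset (Fin n))
    (h : Fin n → ℕ) (m : ℕ) (E : Finset (Fin n × Fin k)) (hm : ∀ v ∈ V, h v ≤ m)
    (hne : ∃ v ∈ V, h v = m) :
    HasAdversaryCertificate (IsExplored V h E) (fun f => (listDigraph f).StronglyConnected)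
      (2 * s ^ 2 * Eᶜ.card + (s ^ 2 + s⁻¹ ^ 2) / 2 * (2 * Vᶜ.card + m)) := by
  induction hd : Eᶜ.card generalizing V h m E with
  | zero =>
    refine (hasAdversaryCertificate_of_const fun x y hx hy => ?_).mono (fun _ => id)
      (by positivity)
    have hE : ∀ e : Fin n × Fin k, e.1 ∈ V → h e.1 = m → e ∈ E := fun e _ _ => by
      have := Finset.card_eq_zero.1 hd
      simpa using (Finset.ext_iff.1 this e)
    rw [hx.stronglyConnected_iff hm hne hE, hy.stronglyConnected_iff hm hne hE]
  | succ d ih =>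
    by_cases hE : ∀ e : Fin n × Fin k, e.1 ∈ V → h e.1 = m → e ∈ E
    · refine (hasAdversaryCertificate_of_const fun x y hx hy => ?_).mono (fun _ => id)
        (by positivity)
      rw [hx.stronglyConnected_iff hm hne hE, hy.stronglyConnected_iff hm hne hE]
    push Not at hE
    obtain ⟨e, heV, hem, heE⟩ := hE
    have hcard : (insert e E)ᶜ.card = d := by
      rw [Finset.compl_insert, Finset.card_erase_of_mem (by simpa using heE), hd]
      rfl
    have hR : 0 ≤ (s ^ 2 + s⁻¹ ^ 2) / 2 := by positivity
    refine HasAdversaryCertificate.query e {a | a ∈ V ∧ h a = m} hs ?_ fun a ha => ?_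
    · refine (ih V h m (insert e E) hm hne hcard).mono
        (fun f hf => hf.1.insert_same_level heV hf.2.1 (hem.trans hf.2.2.symm).le) ?_
      push_cast
      linarith
    · by_cases haV : a ∈ V
      · have ham : h a < m := lt_of_le_of_ne (hm a haV) fun h' => ha ⟨haV, h'⟩
        -- Contraction lowers `m` by at least one, so the potential `2|Vᶜ| + m` pays for the wrong
        -- guess.
        refine (ih V (fun v => min (h v) (h a)) (h a) (insert e E) (fun v _ => min_le_right _ _)
          ⟨a, haV, min_self _⟩ hcard).mono ?_ ?_
        · rintro f ⟨hf, rfl⟩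
          exact hf.contract hm heV hem haV
        · have h1 : (h a : ℝ) + 1 ≤ m := by exact_mod_cast ham
          have h2 := mul_le_mul_of_nonneg_left h1 hR
          push_cast
          nlinarith [sq_nonneg s]
      · refine (ih (insert a V) (Function.update h a (m + 1)) (m + 1) (insert e E) ?_
          ⟨a, Finset.mem_insert_self _ _, Function.update_self _ _ _⟩ hcard).mono ?_ ?_
        · intro v hv
          rcases eq_or_ne v a with rfl | hva
          · simp
          · rw [Function.update_of_ne hva]
            exact (hm v (Finset.mem_of_mem_insert_of_ne hv hva)).trans (Nat.le_succ m)
        · rintro f ⟨hf, rfl⟩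
          exact hf.insert_new_vertex hm heV hem haV
        · have h1 : (insert a V)ᶜ.card + 1 = Vᶜ.card := by
            rw [Finset.compl_insert]
            exact Finset.card_erase_add_one (by simpa using haV)
          rw [← h1]
          push_cast
          nlinarith [sq_nonneg s]

/-- Strong Connectivity has quantum query complexity `O(n √k)`. -/
theorem strongConnectivityQueryComplexity_le (n k : ℕ) [NeZero n] (hk : 0 < k) :
    ∃ T : ℕ, strongConnectivityQueryComplexity n k = T ∧ (T : ℝ) ≤ 577 * (n * Real.sqrt k) := by
  have hk1 : (1 : ℝ) ≤ k := by exact_mod_cast hk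
  have hn1 : (1 : ℝ) ≤ n := by exact_mod_cast NeZero.one_le
  set r := Real.sqrt k with hr
  have hr1 : 1 ≤ r := Real.one_le_sqrt.2 hk1
  have hrk : r * r = k := Real.mul_self_sqrt (by linarith)
  have hs2 : Real.sqrt r⁻¹ ^ 2 = r⁻¹ := Real.sq_sqrt (by positivity)
  have hcert : HasAdversaryCertificate (IsSimpleList (n := n) (k := k))
      (fun f => (listDigraph f).StronglyConnected) (4 * (n * r)) := by
    -- `s² = 1/√k` balances the `nk` cheap queries against the `2n` wrong guesses.
    refine (hasAdversaryCertificate_isExplored (s := Real.sqrt r⁻¹)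
      (Real.sqrt_pos.2 (by positivity)) {0} (fun _ => 0) 0 ∅ (by simp) (by simp)).mono ?_ ?_
    · intro f _
      refine ⟨fun u hu v hv _ => ?_, by simp⟩
      rw [Finset.mem_singleton.1 hu, Finset.mem_singleton.1 hv]
    · have h1 : ((({0} : Finset (Fin n))ᶜ.card : ℕ) : ℝ) ≤ n := by
        exact_mod_cast (Finset.card_le_univ _).trans (Fintype.card_fin n).le
      have h2 : r⁻¹ * k = r := by
        rw [← hrk, inv_mul_cancel_left₀ (by positivity)]
      have h3 : r⁻¹ ≤ r := (inv_le_one_of_one_le₀ hr1).trans hr1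
      rw [inv_pow, hs2, inv_inv]
      simp only [Finset.compl_empty, Finset.card_univ, Fintype.card_prod, Fintype.card_fin]
      push_cast
      calc 2 * r⁻¹ * (n * k) + (r⁻¹ + r) / 2 * (2 * (({0} : Finset (Fin n))ᶜ.card : ℝ) + 0)
          = 2 * (n * (r⁻¹ * k)) + (r⁻¹ + r) * (({0} : Finset (Fin n))ᶜ.card : ℝ) := by ring
        _ ≤ 2 * (n * r) + (r + r) * n := by
          rw [h2]
          gcongr
        _ = 4 * (n * r) := by ring
  have hpos : 1 ≤ n * r := by nlinarith
  obtain ⟨𝒜, hq, hD⟩ := hcert.exists_algorithm (K := ⌈144 * (4 * (n * r))⌉₊)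
    (Nat.ceil_pos.2 (by positivity)) (Nat.le_ceil _)
  have hle : strongConnectivityQueryComplexity n k ≤ (⌈144 * (4 * (n * r))⌉₊ : ℕ∞) :=
    hq ▸ 𝒜.quantumQueryComplexity_le hD
  obtain ⟨T, hT⟩ := ENat.ne_top_iff_exists.1 (ne_top_of_le_ne_top (ENat.natCast_ne_top _) hle)
  refine ⟨T, hT.symm, ?_⟩
  rw [← hT, Nat.cast_le] at hle
  have h1 : (T : ℝ) ≤ ⌈144 * (4 * (n * r))⌉₊ := by exact_mod_cast hle
  have h2 := Nat.ceil_lt_add_one (a := 144 * (4 * (n * r))) (by positivity)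
  linarith

theorem strongConnectivityQueryComplexity_eq_zero (n k : ℕ) [NeZero n] (h : n = 1 ∨ k = 0) :
    strongConnectivityQueryComplexity n k = 0 := by
  refine quantumQueryComplexity_eq_zero_of_const fun f g _ _ => ?_
  rcases h with rfl | rfl
  · have : ∀ f : Fin 1 × Fin k → Fin 1, (listDigraph f).StronglyConnected := fun f s t => by
      rw [Subsingleton.elim s t]
    simp [this]
  · rw [Subsingleton.elim f g]

end StrongConnectivity

/-! ### The bound with the logarithmic factor -/

theorem mainTheorem2 :
    ∃ C : ℝ, 0 < C ∧ ∀ (n k : ℕ) [NeZero n], ∃ T : ℕ,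
      strongConnectivityQueryComplexity n k = (T : ℕ∞) ∧
        (T : ℝ) ≤ C * ((n : ℝ) * Real.sqrt (k : ℝ) * Real.log (n : ℝ)) := by
  refine ⟨1154, by norm_num, fun n k _ => ?_⟩
  -- Here the right-hand side is `0`, so the answer must need no query at all. Otherwise `log n ≥
  -- 1/2`, and `1154 = 2 · 577`.
  by_cases h : n = 1 ∨ k = 0
  · refine ⟨0, strongConnectivityQueryComplexity_eq_zero n k h, ?_⟩
    rcases h with rfl | rfl <;> simp
  · rw [not_or] at h
    obtain ⟨T, hT, hle⟩ := strongConnectivityQueryComplexity_le n k (Nat.pos_of_ne_zero h.2)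
    refine ⟨T, hT, hle.trans ?_⟩
    have hn : (2 : ℝ) ≤ n := by
      have := NeZero.ne n
      exact_mod_cast (by omega : 2 ≤ n)
    have hlog : 1 / 2 ≤ Real.log n :=
      (by linarith [Real.log_two_gt_d9] : (1 / 2 : ℝ) ≤ Real.log 2).trans
        (Real.log_le_log (by norm_num) hn)
    have hnr : 0 ≤ (n : ℝ) * Real.sqrt k := by positivity
    nlinarith
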